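/- **Proposition 3.6.** Let $\theta>0$, $\sigma\in\mathbb R$, and let $W$ be a Gaussian white noise on $\mathbb R$ (space only) defined on a probability space $(\Omega,\mathcal F,\mathbb P)$, i.e. a centred Gaussian family $\big(\int_{\mathbb R} f\,dW\big)_{f\in L^2(\mathbb R)}$ with $\mathbb E\big[\int f\,dW\int g\,dW\big]=\int_{\mathbb R} f(y)g(y)\,dy$. Let $u$ be the mild solution on $\mathbb R$ of $\partial_t u=\theta\,\partial_{xx}u+\sigma\dot W(x)$, $u(0,\cdot)=0$, i.e. for all $t\ge 0$ and $x\in\mathbb R$, almost surely, $$u(t,x)=\sigma\int_0^t\int_{\mathbb R}P(t-s,x-y)\,dW(y)\,ds,\qquad P(s,z)=\frac{1}{\sqrt{4\pi\theta s}}\,e^{-|z|^2/(4\theta s)},$$ where the integral in $s$ is a Bochner integral in $L^2(\Omega)$. Let $a,b\ge 0$ with $a+b>0$ and, for $h>0$, put $$\Delta_h u(t,x)=\frac{u(t,x+ah)-u(t,x-bh)}{(a+b)h}.$$ Let $A<B$ be real numbers and let $\gamma\ge 1$ be real. Then for every $t>0$ and $x\in\mathbb R$, $$\lim_{N\to\infty}N\,\mathbb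 E\left|\Delta_{\frac{B-A}{N^\gamma}}u\Big(t,x+\frac{B-A}{N}\Big)-\Delta_{\frac{B-A}{N^\gamma}}u(t,x)\right|^2=\frac{\mu\,\sigma^2(B-A)}{\theta^2},$$ where $$\mu=\begin{cases}\dfrac1{a+b}-\dfrac1{3(a+b)^2}, & \gamma=1,\ a+b\ge 1,\\[2mm] 1-\dfrac{a+b}{3}, & \gamma=1,\ a+b<1,\\[2mm] 1, & \gamma>1.\end{cases}$$ -/

import Mathlib

open MeasureTheory ProbabilityTheory Filter Topology

noncomputable section

namespace SpaceNoiseHeat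

/-- Gaussian white noise on `ℝ`, as an isonormal Gaussian process over `L²(ℝ)`: a centred Gaussian
family `f ↦ W f`, where `W f` stands for `∫ f(y) dW(y)`, with covariance
`E[W f * W g] = ∫ f g`. This is the precise meaning of `E[Ẇ(x) Ẇ(y)] = δ(x - y)`. -/
structure IsWhiteNoise {Ω : Type*} [MeasurableSpace Ω]
    (W : Lp ℝ 2 (volume : Measure ℝ) → Ω → ℝ) (P : Measure Ω) : Prop where
  gaussian : IsGaussianProcess W P
  mean_zero : ∀ f, ∫ ω, W f ω ∂P = 0
  covariance : ∀ f g, ∫ ω, W f ω * W g ω ∂P = ∫ y, f y * g y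

theorem IsWhiteNoise.memLp {Ω : Type*} [MeasurableSpace Ω]
    {W : Lp ℝ 2 (volume : Measure ℝ) → Ω → ℝ} {P : Measure Ω} (hW : IsWhiteNoise W P)
    (f : Lp ℝ 2 (volume : Measure ℝ)) : MemLp (W f) 2 P :=
  (hW.gaussian.hasGaussianLaw_eval f).memLp_two

/-- The Wiener integral `∫ f(y) dW(y)`, as an element of `L²(Ω)`. -/
def IsWhiteNoise.integral {Ω : Type*} [MeasurableSpace Ω]
    {W : Lp ℝ 2 (volume : Measure ℝ) → Ω → ℝ} {P : Measure Ω} (hW : IsWhiteNoise W P)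
    (f : Lp ℝ 2 (volume : Measure ℝ)) : Lp ℝ 2 P :=
  (hW.memLp f).toLp (W f)

/-- The heat kernel `P(s, z) = (4πθs)^{-1/2} exp(-z² / (4θs))` of `∂ₛ - θ ∂ₓₓ`
(equal to `0` when `θ s ≤ 0`). -/
def heatKernel (θ s z : ℝ) : ℝ :=
  1 / √(4 * Real.pi * θ * s) * Real.exp (-|z| ^ 2 / (4 * θ * s))

theorem memLp_heatKernel (θ s x : ℝ) :
    MemLp (fun y : ℝ => heatKernel θ s (x - y)) 2 (volume : Measure ℝ) := by
  have hcont : Continuous (fun y : ℝ => heatKernel θ s (x - y)) := by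
    unfold heatKernel
    fun_prop
  rcases le_or_gt (θ * s) 0 with h | h
  · have h0 : (fun y : ℝ => heatKernel θ s (x - y)) = fun _ => 0 := by
      funext y
      have : 4 * Real.pi * θ * s ≤ 0 := by nlinarith [Real.pi_pos]
      simp [heatKernel, Real.sqrt_eq_zero_of_nonpos this]
    rw [h0]
    exact MemLp.zero'
  · rw [memLp_two_iff_integrable_sq hcont.aestronglyMeasurable]
    have hb : 0 < 1 / (2 * (θ * s)) := by positivity
    have h1 := (((integrable_exp_neg_mul_sq hb).comp_sub_left x).const_mul
      ((1 / √(4 * Real.pi * θ * s)) ^ 2))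
    refine h1.congr (Filter.Eventually.of_forall fun y => ?_)
    simp only [heatKernel, mul_pow, sq_abs]
    congr 1
    rw [← Real.exp_nat_mul]
    congr 1
    have hθ : θ ≠ 0 := by rintro rfl; simp at h
    have hs : s ≠ 0 := by rintro rfl; simp at h
    push_cast
    field_simp
    ring

/-- The function `y ↦ P(s, x - y)` as an element of `L²(ℝ)`. -/
def heatKernelLp (θ s x : ℝ) : Lp ℝ 2 (volume : Measure ℝ) :=
  (memLp_heatKernel θ s x).toLp (fun y : ℝ => heatKernel θ s (x - y))

/-- The random variable `σ ∫₀ᵗ ∫_ℝ P(t - s, x - y) dW(y) ds`; the outer integral is the Bochner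
integral of the `L²(Ω)`-valued function `s ↦ ∫_ℝ P(t - s, x - y) dW(y)`. -/
def mildIntegral {Ω : Type*} [MeasurableSpace Ω]
    {W : Lp ℝ 2 (volume : Measure ℝ) → Ω → ℝ} {P : Measure Ω} (hW : IsWhiteNoise W P)
    (θ σ t x : ℝ) : Lp ℝ 2 P :=
  σ • ∫ s in (0 : ℝ)..t, hW.integral (heatKernelLp θ (t - s) x)

/-- The random field `u` is (a version of) the mild solution on `ℝ` of
`∂ₜ u = θ ∂ₓₓ u + σ Ẇ(x)`, `u(0, ·) = 0`. -/
def IsMildSolution {Ω : Type*} [MeasurableSpace Ω]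
    {W : Lp ℝ 2 (volume : Measure ℝ) → Ω → ℝ} {P : Measure Ω} (hW : IsWhiteNoise W P)
    (θ σ : ℝ) (u : ℝ → ℝ → Ω → ℝ) : Prop :=
  ∀ t x : ℝ, 0 ≤ t → u t x =ᵐ[P] mildIntegral hW θ σ t x

/-- The spatial difference quotient `(f(x + ah) - f(x - bh)) / ((a + b) h)`. -/
def diffQuot (a b h : ℝ) (f : ℝ → ℝ) (x : ℝ) : ℝ :=
  (f (x + a * h) - f (x - b * h)) / ((a + b) * h)

open Classical in
/-- The constant `μ`, for `γ ≥ 1`. -/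
def biasFactor (γ a b : ℝ) : ℝ :=
  if γ = 1 then
    if 1 ≤ a + b then 1 / (a + b) - 1 / (3 * (a + b) ^ 2) else 1 - (a + b) / 3
  else 1

end SpaceNoiseHeat

end

/-!
The increment of the difference quotient is a linear combination of four values of `u(t, ·)`, so its
second moment is a mixed second difference of the covariance function of `u(t, ·)`, and everything
rests on the singularity of that function at the diagonal.

For `σ = 1` the isometry of the white noise and the semigroup property of the heat kernel give
`E[u(t, x) u(t, x')] = ∫₀ᵗ ∫₀ᵗ P(r + s, x - x') ds dr` (`inner_timeIntegral`). Since
`|z|³ / (12 θ²)` is a fundamental solution of `θ² ∂_z⁴`, its evolution `F(s, z)` under the heat flow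
satisfies `∂ₛ² F = θ² ∂_z⁴ F = P`. So the double integral equals
`F(2t, z) - 2 F(t, z) + |z|³ / (12 θ²)` (`integral_integral_heatKernel`). The computations are done
with the closed form of `F` in terms of the error function (`smoothedCube`).

At positive times `F` has a bounded fourth derivative in `z`, so with steps `d = (B - A) / N` and
`l = (a + b)(B - A) / N ^ γ` its mixed second difference is `O(d² l²)`
(`exists_abs_secondDiff_covSmooth_le`). After multiplication by `N / l²` it disappears in the limit.
The mixed second difference of `|z|³ / 12` is exactly `m² M - m³ / 3`, where `m` and `M` are the
smaller and the larger of `d` and `l` (`kinkVariance_of_le`). This gives the three cases of the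
constant (`tendsto_kinkVariance_biasFactor`).
-/

noncomputable section

namespace SpaceNoiseHeat

/-! ### The primitive of the Gaussian and heat-smoothed powers of `|z|` -/

/-- The primitive `∫₀ˣ exp (-w²) dw` of the Gaussian, i.e. `√π / 2` times the error function. -/
def gaussPrim (x : ℝ) : ℝ := ∫ w in (0 : ℝ)..x, Real.exp (-1 * w ^ 2)

theorem hasDerivAt_gaussPrim (x : ℝ) : HasDerivAt gaussPrim (Real.exp (-1 * x ^ 2)) x := by
  have hc : Continuous fun w : ℝ => Real.exp (-1 * w ^ 2) := by fun_prop
  exact (hc.integral_hasStrictDerivAt 0 x).hasDerivAt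

theorem gaussPrim_neg (x : ℝ) : gaussPrim (-x) = -gaussPrim x := by
  have h := intervalIntegral.integral_comp_neg (a := 0) (b := x)
    (fun w : ℝ => Real.exp (-1 * w ^ 2))
  simp only [neg_zero, neg_sq] at h
  rw [gaussPrim, gaussPrim, intervalIntegral.integral_symm, ← h]

theorem tendsto_gaussPrim_atTop : Tendsto gaussPrim atTop (𝓝 (√Real.pi / 2)) := by
  have h := intervalIntegral_tendsto_integral_Ioi (0 : ℝ)
    (integrable_exp_neg_mul_sq (b := 1) one_pos).integrableOn tendsto_id
  rw [integral_gaussian_Ioi, div_one] at h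
  exact h

/-- The mean `E|z + r Z / √2|`, for `Z` standard Gaussian and `r > 0`, in closed form. With
`r = √(4θs)` it is the solution at time `s` of `∂ₛ = θ ∂_zz` started from `|z|`. -/
def smoothedAbs (r z : ℝ) : ℝ :=
  (2 * z * gaussPrim (z / r) + r * Real.exp (-1 * (z / r) ^ 2)) / √Real.pi

/-- The mean `E|z + r Z / √2|³`, for `Z` standard Gaussian and `r > 0`, in closed form. With
`r = √(4θs)` it is the solution at time `s` of `∂ₛ = θ ∂_zz` started from `|z|³`. -/
def smoothedCube (r z : ℝ) : ℝ :=
  ((2 * z ^ 3 + 3 * r ^ 2 * z) * gaussPrim (z / r)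
    + (z ^ 2 + r ^ 2) * r * Real.exp (-1 * (z / r) ^ 2)) / √Real.pi

theorem hasDerivAt_gaussPrim_div_left {r : ℝ} (z : ℝ) :
    HasDerivAt (fun z => gaussPrim (z / r)) (Real.exp (-1 * (z / r) ^ 2) * (1 / r)) z :=
  HasDerivAt.comp (h := fun z => z / r) z (hasDerivAt_gaussPrim (z / r))
    ((hasDerivAt_id' z).div_const r)

theorem hasDerivAt_const_div {r : ℝ} (hr : r ≠ 0) (z : ℝ) :
    HasDerivAt (fun r => z / r) (-z / r ^ 2) r := by
  have h := (hasDerivAt_inv hr).const_mul z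
  refine h.congr_deriv ?_
  ring

theorem hasDerivAt_gaussPrim_div_right {r : ℝ} (hr : r ≠ 0) (z : ℝ) :
    HasDerivAt (fun r => gaussPrim (z / r)) (Real.exp (-1 * (z / r) ^ 2) * (-z / r ^ 2)) r :=
  HasDerivAt.comp (h := fun r => z / r) r (hasDerivAt_gaussPrim (z / r))
    (hasDerivAt_const_div hr z)

theorem hasDerivAt_exp_neg_sq (x : ℝ) :
    HasDerivAt (fun x => Real.exp (-1 * x ^ 2)) (Real.exp (-1 * x ^ 2) * (-1 * (2 * x))) x := by
  simpa using ((hasDerivAt_pow 2 x).const_mul (-1)).exp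

theorem hasDerivAt_exp_div_left {r : ℝ} (z : ℝ) :
    HasDerivAt (fun z => Real.exp (-1 * (z / r) ^ 2))
      (Real.exp (-1 * (z / r) ^ 2) * (-2 * z / r ^ 2)) z := by
  have h := HasDerivAt.comp (h := fun z => z / r) z (hasDerivAt_exp_neg_sq (z / r))
    ((hasDerivAt_id' z).div_const r)
  refine h.congr_deriv ?_
  ring

theorem hasDerivAt_exp_div_right {r : ℝ} (hr : r ≠ 0) (z : ℝ) :
    HasDerivAt (fun r => Real.exp (-1 * (z / r) ^ 2))
      (Real.exp (-1 * (z / r) ^ 2) * (2 * z ^ 2 / r ^ 3)) r := by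
  have h := HasDerivAt.comp (h := fun r => z / r) r (hasDerivAt_exp_neg_sq (z / r))
    (hasDerivAt_const_div hr z)
  refine h.congr_deriv ?_
  field_simp

theorem hasDerivAt_smoothedAbs_right {r : ℝ} (hr : r ≠ 0) (z : ℝ) :
    HasDerivAt (smoothedAbs r) (2 * gaussPrim (z / r) / √Real.pi) z := by
  have h := ((((hasDerivAt_id z).const_mul 2).mul (hasDerivAt_gaussPrim_div_left (r := r) z)).add
    ((hasDerivAt_exp_div_left (r := r) z).const_mul r)).div_const √Real.pi
  refine h.congr_deriv ?_
  simp only [id]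
  congr 1
  field_simp
  ring

theorem hasDerivAt_smoothedAbs_deriv {r : ℝ} (z : ℝ) :
    HasDerivAt (fun z => 2 * gaussPrim (z / r) / √Real.pi)
      (2 * (Real.exp (-1 * (z / r) ^ 2) * (1 / r)) / √Real.pi) z :=
  ((hasDerivAt_gaussPrim_div_left z).const_mul 2).div_const _

theorem hasDerivAt_smoothedAbs_left {r : ℝ} (hr : r ≠ 0) (z : ℝ) :
    HasDerivAt (fun r => smoothedAbs r z) (Real.exp (-1 * (z / r) ^ 2) / √Real.pi) r := by
  have h := (((hasDerivAt_gaussPrim_div_right hr z).const_mul (2 * z)).add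
    ((hasDerivAt_id r).mul (hasDerivAt_exp_div_right hr z))).div_const √Real.pi
  refine h.congr_deriv ?_
  simp only [id]
  congr 1
  field_simp
  ring

/-- The first `z`-derivative of `smoothedCube r`. -/
def smoothedCubeDeriv (r z : ℝ) : ℝ :=
  3 * ((2 * z ^ 2 + r ^ 2) * gaussPrim (z / r) + r * z * Real.exp (-1 * (z / r) ^ 2)) / √Real.pi

theorem hasDerivAt_smoothedCube_right {r : ℝ} (hr : r ≠ 0) (z : ℝ) :
    HasDerivAt (smoothedCube r) (smoothedCubeDeriv r z) z := by
  have h := ((((((hasDerivAt_id z).pow 3).const_mul 2).add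
      ((hasDerivAt_id z).const_mul (3 * r ^ 2))).mul
      (hasDerivAt_gaussPrim_div_left (r := r) z)).add
    (((((hasDerivAt_id z).pow 2).add_const (r ^ 2)).mul_const r).mul
      (hasDerivAt_exp_div_left (r := r) z))).div_const √Real.pi
  refine h.congr_deriv ?_
  simp [smoothedCubeDeriv]
  field_simp
  ring

theorem hasDerivAt_smoothedCubeDeriv {r : ℝ} (hr : r ≠ 0) (z : ℝ) :
    HasDerivAt (smoothedCubeDeriv r) (6 * smoothedAbs r z) z := by
  have h := (((((((hasDerivAt_id z).pow 2).const_mul 2).add_const (r ^ 2)).mul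
      (hasDerivAt_gaussPrim_div_left (r := r) z)).add
    (((hasDerivAt_id z).const_mul r).mul
      (hasDerivAt_exp_div_left (r := r) z))).const_mul 3).div_const √Real.pi
  refine h.congr_deriv ?_
  simp [smoothedAbs]
  field_simp
  ring

theorem hasDerivAt_smoothedCube_left {r : ℝ} (hr : r ≠ 0) (z : ℝ) :
    HasDerivAt (fun r => smoothedCube r z) (3 * r * smoothedAbs r z) r := by
  have h := ((((((hasDerivAt_id r).pow 2).const_mul 3).mul_const z).const_add (2 * z ^ 3)).mul
      (hasDerivAt_gaussPrim_div_right hr z)).add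
    (((((hasDerivAt_id r).pow 2).const_add (z ^ 2)).mul (hasDerivAt_id r)).mul
      (hasDerivAt_exp_div_right hr z)) |>.div_const √Real.pi
  refine h.congr_deriv ?_
  simp [smoothedAbs]
  field_simp
  ring

theorem smoothedCube_abs (r z : ℝ) : smoothedCube r |z| = smoothedCube r z := by
  rcases abs_choice z with h | h <;> rw [h]
  simp only [smoothedCube, neg_div, gaussPrim_neg]
  ring_nf

theorem tendsto_smoothedCube_zero (z : ℝ) :
    Tendsto (fun r => smoothedCube r z) (𝓝[>] 0) (𝓝 (|z| ^ 3)) := by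
  have hπ : √Real.pi ≠ 0 := by positivity
  have hr : Tendsto (fun r : ℝ => r) (𝓝[>] 0) (𝓝 0) := tendsto_nhdsWithin_of_tendsto_nhds tendsto_id
  have hE : Tendsto (fun r : ℝ => (|z| ^ 2 + r ^ 2) * r * Real.exp (-1 * (|z| / r) ^ 2))
      (𝓝[>] 0) (𝓝 0) := by
    have h0 : Tendsto (fun r : ℝ => (|z| ^ 2 + r ^ 2) * r) (𝓝[>] 0) (𝓝 0) := by
      simpa only [mul_zero] using ((hr.pow 2).const_add (|z| ^ 2)).mul hr
    refine squeeze_zero' ?_ ?_ h0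
    · filter_upwards [self_mem_nhdsWithin] with r (hr : 0 < r)
      positivity
    · filter_upwards [self_mem_nhdsWithin] with r (hr : 0 < r)
      refine mul_le_of_le_one_right (by positivity) (Real.exp_le_one_iff.2 ?_)
      nlinarith [sq_nonneg (|z| / r)]
  have hG : Tendsto (fun r : ℝ => (2 * |z| ^ 3 + 3 * r ^ 2 * |z|) * gaussPrim (|z| / r))
      (𝓝[>] 0) (𝓝 (2 * |z| ^ 3 * (√Real.pi / 2))) := by
    rcases eq_or_ne z 0 with rfl | hz
    · simp
    · have hdiv : Tendsto (fun r : ℝ => |z| / r) (𝓝[>] 0) atTop :=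
        tendsto_inv_nhdsGT_zero.const_mul_atTop (abs_pos.2 hz)
      have h0 : Tendsto (fun r : ℝ => 2 * |z| ^ 3 + 3 * r ^ 2 * |z|) (𝓝[>] 0)
          (𝓝 (2 * |z| ^ 3)) := by
        simpa using (((hr.pow 2).const_mul 3).mul_const |z|).const_add (2 * |z| ^ 3)
      exact h0.mul (tendsto_gaussPrim_atTop.comp hdiv)
  have h := (hG.add hE).div_const √Real.pi
  have hlim : (2 * |z| ^ 3 * (√Real.pi / 2) + 0) / √Real.pi = |z| ^ 3 := by field_simp; ring
  rw [hlim] at h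
  exact h.congr fun r => smoothedCube_abs r z

/-! ### Time primitives of the heat kernel -/

theorem heatKernel_eq {θ s : ℝ} (z : ℝ) (hs : 0 < θ * s) :
    heatKernel θ s z
      = Real.exp (-1 * (z / √(4 * θ * s)) ^ 2) / (√Real.pi * √(4 * θ * s)) := by
  have h4 : 0 ≤ 4 * θ * s := by nlinarith
  rw [heatKernel, div_pow, Real.sq_sqrt h4, ← Real.sqrt_mul Real.pi_pos.le, sq_abs,
    div_mul_eq_mul_div, one_mul]
  rw [show 4 * Real.pi * θ * s = Real.pi * (4 * θ * s) by ring, neg_one_mul, neg_div]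

theorem hasDerivAt_sqrt_time {θ s : ℝ} (hθ : 0 < θ) (hs : 0 < s) :
    HasDerivAt (fun s => √(4 * θ * s)) (2 * θ / √(4 * θ * s)) s := by
  have h := ((hasDerivAt_id s).const_mul (4 * θ)).sqrt (by simp only [id]; positivity)
  refine h.congr_deriv ?_
  simp only [id]
  field_simp
  ring

/-- The function `smoothedAbs √(4θs) z / (2θ)` is a primitive in `s` of the heat kernel. -/
theorem hasDerivAt_smoothedAbs_time {θ s : ℝ} (hθ : 0 < θ) (hs : 0 < s) (z : ℝ) :
    HasDerivAt (fun s => smoothedAbs √(4 * θ * s) z / (2 * θ)) (heatKernel θ s z) s := by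
  have hr : 0 < √(4 * θ * s) := Real.sqrt_pos.2 (by positivity)
  have h := ((hasDerivAt_smoothedAbs_left hr.ne' z).comp s (hasDerivAt_sqrt_time hθ hs)).div_const
    (2 * θ)
  refine h.congr_deriv ?_
  rw [heatKernel_eq z (mul_pos hθ hs)]
  field_simp

/-- The function `smoothedCube √(4θs) z / (12θ²)` is a second primitive in `s` of the heat kernel. -/
theorem hasDerivAt_smoothedCube_time {θ s : ℝ} (hθ : 0 < θ) (hs : 0 < s) (z : ℝ) :
    HasDerivAt (fun s => smoothedCube √(4 * θ * s) z / (12 * θ ^ 2))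
      (smoothedAbs √(4 * θ * s) z / (2 * θ)) s := by
  have hr : 0 < √(4 * θ * s) := Real.sqrt_pos.2 (by positivity)
  have h := ((hasDerivAt_smoothedCube_left hr.ne' z).comp s (hasDerivAt_sqrt_time hθ hs)).div_const
    (12 * θ ^ 2)
  refine h.congr_deriv ?_
  field_simp
  ring

theorem tendsto_smoothedCube_time_zero {θ : ℝ} (hθ : 0 < θ) (z : ℝ) :
    Tendsto (fun s => smoothedCube √(4 * θ * s) z / (12 * θ ^ 2)) (𝓝[>] 0)
      (𝓝 (|z| ^ 3 / (12 * θ ^ 2))) := by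
  have hr : Tendsto (fun s => √(4 * θ * s)) (𝓝[>] 0) (𝓝[>] 0) := by
    refine tendsto_nhdsWithin_iff.2 ⟨?_, ?_⟩
    · have hc : Continuous fun s => √(4 * θ * s) := by fun_prop
      simpa using (hc.tendsto 0).mono_left nhdsWithin_le_nhds
    · filter_upwards [self_mem_nhdsWithin] with s (hs : 0 < s)
      exact Real.sqrt_pos.2 (by positivity)
  exact ((tendsto_smoothedCube_zero z).comp hr).div_const _

theorem continuousAt_heatKernel_time {θ s : ℝ} (hs : 0 < θ * s) (z : ℝ) :
    ContinuousAt (fun s => heatKernel θ s z) s := by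
  have h1 : √(4 * Real.pi * θ * s) ≠ 0 := by
    refine (Real.sqrt_pos.2 ?_).ne'
    nlinarith [Real.pi_pos, mul_pos Real.pi_pos hs]
  have h2 : 4 * θ * s ≠ 0 := by nlinarith
  unfold heatKernel
  fun_prop (disch := assumption)

theorem integral_heatKernel_time {θ r t : ℝ} (hθ : 0 < θ) (hr : 0 < r) (ht : 0 < t) (z : ℝ) :
    ∫ s in (0 : ℝ)..t, heatKernel θ (r + s) z
      = smoothedAbs √(4 * θ * (r + t)) z / (2 * θ) - smoothedAbs √(4 * θ * r) z / (2 * θ) := by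
  have hmem : ∀ s ∈ Set.uIcc 0 t, 0 < r + s := fun s hs => by
    rw [Set.uIcc_of_le ht.le] at hs; linarith [hs.1]
  rw [intervalIntegral.integral_eq_sub_of_hasDerivAt
    (f := fun s => smoothedAbs √(4 * θ * (r + s)) z / (2 * θ))]
  · simp
  · exact fun s hs => (hasDerivAt_smoothedAbs_time hθ (hmem s hs) z).comp_const_add r s
  · refine ContinuousOn.intervalIntegrable fun s hs => ContinuousAt.continuousWithinAt ?_
    exact ContinuousAt.comp (f := fun s => r + s)
      (continuousAt_heatKernel_time (mul_pos hθ (hmem s hs)) z) (by fun_prop)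

/-- The smooth part `F(2t, z) - 2 F(t, z)` of the covariance function of `u(t, ·)` for `σ = 1`, where
`F(s, z) = smoothedCube √(4θs) z / (12θ²)`. -/
def covSmooth (θ t z : ℝ) : ℝ :=
  smoothedCube √(4 * θ * (t + t)) z / (12 * θ ^ 2)
    - 2 * (smoothedCube √(4 * θ * t) z / (12 * θ ^ 2))

/-- The covariance function is the kink `|z|³ / (12θ²)` plus a smooth function. -/
theorem integral_integral_heatKernel {θ t : ℝ} (hθ : 0 < θ) (ht : 0 < t) (z : ℝ)
    (hint : IntervalIntegrable (fun r => ∫ s in (0 : ℝ)..t, heatKernel θ (r + s) z) volume 0 t) :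
    ∫ r in (0 : ℝ)..t, ∫ s in (0 : ℝ)..t, heatKernel θ (r + s) z
      = |z| ^ 3 / (12 * θ ^ 2) + covSmooth θ t z := by
  -- The closed form is not continuous at time `0`, so the lower boundary term is a limit.
  have hd : ∀ s, 0 < s → HasDerivAt
      (fun r => smoothedCube √(4 * θ * (r + t)) z / (12 * θ ^ 2)
        - smoothedCube √(4 * θ * r) z / (12 * θ ^ 2))
      (∫ s' in (0 : ℝ)..t, heatKernel θ (s + s') z) s := fun s hs => by
    rw [integral_heatKernel_time hθ hs ht]
    exact ((hasDerivAt_smoothedCube_time hθ (add_pos hs ht) z).comp_add_const s t).sub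
      (hasDerivAt_smoothedCube_time hθ hs z)
  have h0 := (((hasDerivAt_smoothedCube_time hθ (by simpa using ht) z).comp_add_const 0 t
    ).continuousAt.tendsto.mono_left (nhdsWithin_le_nhds (s := Set.Ioi 0))).sub
      (tendsto_smoothedCube_time_zero hθ z)
  have h1 := (hd t ht).continuousAt.tendsto.mono_left (nhdsWithin_le_nhds (s := Set.Iio t))
  rw [intervalIntegral.integral_eq_sub_of_hasDerivAt_of_tendsto ht (fun s hs => hd s hs.1) hint
    h0 h1, covSmooth, zero_add]
  ring

/-! ### Second differences -/

/-- The symmetric second difference `f (z + d) + f (z - d) - 2 f z`. -/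
def secondDiff (d : ℝ) (f : ℝ → ℝ) (z : ℝ) : ℝ := f (z + d) + f (z - d) - 2 * f z

theorem hasDerivAt_secondDiff {f f' : ℝ → ℝ} (hf : ∀ z, HasDerivAt f (f' z) z) (d z : ℝ) :
    HasDerivAt (secondDiff d f) (secondDiff d f' z) z :=
  (((hf (z + d)).comp_add_const z d).add ((hf (z - d)).comp_sub_const z d)).sub
    ((hf z).const_mul 2)

theorem abs_secondDiff_le {f f' f'' : ℝ → ℝ} (hf : ∀ z, HasDerivAt f (f' z) z)
    (hf' : ∀ z, HasDerivAt f' (f'' z) z) {C : ℝ} (hC : ∀ z, |f'' z| ≤ C) {d : ℝ} (hd : 0 ≤ d)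
    (z : ℝ) : |secondDiff d f z| ≤ C * (2 * d) * d := by
  have hC0 : 0 ≤ C := (abs_nonneg _).trans (hC 0)
  have hφ : ∀ s ∈ Set.Icc 0 d, HasDerivWithinAt (fun s => f (z + s) + f (z - s))
      (f' (z + s) - f' (z - s)) (Set.Icc 0 d) s := fun s _ => by
    have := ((hf (z + s)).comp_const_add z s).add ((hf (z - s)).comp_const_sub z s)
    exact this.hasDerivWithinAt
  have hb : ∀ s ∈ Set.Icc 0 d, ‖f' (z + s) - f' (z - s)‖ ≤ C * (2 * d) := fun s hs => by
    have h := convex_univ.norm_image_sub_le_of_norm_hasDerivWithin_le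
      (fun y _ => (hf' y).hasDerivWithinAt) (fun y _ => hC y)
      (Set.mem_univ (z - s)) (Set.mem_univ (z + s))
    refine h.trans (mul_le_mul_of_nonneg_left ?_ hC0)
    rw [Real.norm_eq_abs, abs_le]
    constructor <;> linarith [hs.1, hs.2]
  have h := (convex_Icc 0 d).norm_image_sub_le_of_norm_hasDerivWithin_le hφ hb
    (Set.left_mem_Icc.2 hd) (Set.right_mem_Icc.2 hd)
  simp only [add_zero, sub_zero, Real.norm_eq_abs, abs_of_nonneg hd] at h
  rwa [secondDiff, two_mul]

theorem abs_secondDiff_secondDiff_le {f f₁ f₂ f₃ f₄ : ℝ → ℝ} (h0 : ∀ z, HasDerivAt f (f₁ z) z)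
    (h1 : ∀ z, HasDerivAt f₁ (f₂ z) z) (h2 : ∀ z, HasDerivAt f₂ (f₃ z) z)
    (h3 : ∀ z, HasDerivAt f₃ (f₄ z) z) {C : ℝ} (hC : ∀ z, |f₄ z| ≤ C) {d l : ℝ} (hd : 0 ≤ d)
    (hl : 0 ≤ l) (z : ℝ) : |secondDiff d (secondDiff l f) z| ≤ 4 * C * d ^ 2 * l ^ 2 := by
  have h := abs_secondDiff_le (hasDerivAt_secondDiff h0 l) (hasDerivAt_secondDiff h1 l)
    (abs_secondDiff_le h2 h3 hC hl) hd z
  exact h.trans_eq (by ring)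

/-- The fourth `z`-derivative of `smoothedCube r` is a bounded Gaussian, whence the order of its
mixed second differences. -/
theorem abs_secondDiff_smoothedCube_le {r : ℝ} (hr : 0 < r) {d l : ℝ} (hd : 0 ≤ d) (hl : 0 ≤ l)
    (z : ℝ) : |secondDiff d (secondDiff l (smoothedCube r)) z|
      ≤ 4 * (12 / (r * √Real.pi)) * d ^ 2 * l ^ 2 := by
  refine abs_secondDiff_secondDiff_le (hasDerivAt_smoothedCube_right hr.ne')
    (hasDerivAt_smoothedCubeDeriv hr.ne')
    (fun z => (hasDerivAt_smoothedAbs_right hr.ne' z).const_mul 6)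
    (fun z => (hasDerivAt_smoothedAbs_deriv z).const_mul 6) (fun z => ?_) hd hl z
  have he : Real.exp (-1 * (z / r) ^ 2) ≤ 1 :=
    Real.exp_le_one_iff.2 (by nlinarith [sq_nonneg (z / r)])
  rw [abs_of_nonneg (by positivity)]
  calc 6 * (2 * (Real.exp (-1 * (z / r) ^ 2) * (1 / r)) / √Real.pi)
      = Real.exp (-1 * (z / r) ^ 2) * (12 / (r * √Real.pi)) := by field_simp; ring
    _ ≤ 12 / (r * √Real.pi) := mul_le_of_le_one_left (by positivity) he

theorem exists_abs_secondDiff_covSmooth_le {θ t : ℝ} (hθ : 0 < θ) (ht : 0 < t) :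
    ∃ C, ∀ d l, 0 ≤ d → 0 ≤ l →
      |secondDiff d (secondDiff l (covSmooth θ t)) 0| ≤ C * d ^ 2 * l ^ 2 := by
  have hr1 : 0 < √(4 * θ * (t + t)) := Real.sqrt_pos.2 (by positivity)
  have hr2 : 0 < √(4 * θ * t) := Real.sqrt_pos.2 (by positivity)
  refine ⟨4 * (12 / (√(4 * θ * (t + t)) * √Real.pi)) / (12 * θ ^ 2)
    + 2 * (4 * (12 / (√(4 * θ * t) * √Real.pi)) / (12 * θ ^ 2)), fun d l hd hl => ?_⟩
  have hsplit : secondDiff d (secondDiff l (covSmooth θ t)) 0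
      = secondDiff d (secondDiff l (smoothedCube √(4 * θ * (t + t)))) 0 / (12 * θ ^ 2)
        - 2 * (secondDiff d (secondDiff l (smoothedCube √(4 * θ * t))) 0 / (12 * θ ^ 2)) := by
    simp only [secondDiff, covSmooth]
    ring
  rw [hsplit]
  have hb : ∀ r, 0 < r → |secondDiff d (secondDiff l (smoothedCube r)) 0 / (12 * θ ^ 2)|
      ≤ 4 * (12 / (r * √Real.pi)) * d ^ 2 * l ^ 2 / (12 * θ ^ 2) := fun r hr => by
    rw [abs_div, abs_of_pos (show (0 : ℝ) < 12 * θ ^ 2 by positivity)]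
    gcongr
    exact abs_secondDiff_smoothedCube_le hr hd hl 0
  have h1 := abs_le.1 (hb _ hr1)
  have h2 := abs_le.1 (hb _ hr2)
  have hC : (4 * (12 / (√(4 * θ * (t + t)) * √Real.pi)) / (12 * θ ^ 2)
      + 2 * (4 * (12 / (√(4 * θ * t) * √Real.pi)) / (12 * θ ^ 2))) * d ^ 2 * l ^ 2
      = 4 * (12 / (√(4 * θ * (t + t)) * √Real.pi)) * d ^ 2 * l ^ 2 / (12 * θ ^ 2)
        + 2 * (4 * (12 / (√(4 * θ * t) * √Real.pi)) * d ^ 2 * l ^ 2 / (12 * θ ^ 2)) := by ring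
  rw [hC, abs_le]
  constructor <;> linarith [h1.1, h1.2, h2.1, h2.2]

/-! ### The covariance function of the solution -/

/-- Semigroup property of the heat kernel. -/
theorem integral_heatKernel_mul_heatKernel {θ r s : ℝ} (hθ : 0 < θ) (hr : 0 < r) (hs : 0 < s)
    (x x' : ℝ) :
    ∫ y, heatKernel θ r (x - y) * heatKernel θ s (x' - y) = heatKernel θ (r + s) (x - x') := by
  set β : ℝ := (r + s) / (4 * θ * r * s) with hβ
  set m : ℝ := (s * x + r * x') / (r + s) with hm
  have hrs : 0 < r + s := add_pos hr hs
  have hprod : ∀ y, heatKernel θ r (x - y) * heatKernel θ s (x' - y)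
      = (1 / √(4 * Real.pi * θ * r) * (1 / √(4 * Real.pi * θ * s))
          * Real.exp (-|x - x'| ^ 2 / (4 * θ * (r + s)))) * Real.exp (-β * (y - m) ^ 2) := fun y => by
    have he : -|x - y| ^ 2 / (4 * θ * r) + -|x' - y| ^ 2 / (4 * θ * s)
        = -|x - x'| ^ 2 / (4 * θ * (r + s)) + -β * (y - m) ^ 2 := by
      simp only [sq_abs, hβ, hm]
      field_simp
      ring
    simp only [heatKernel]
    rw [mul_mul_mul_comm, ← Real.exp_add, he, Real.exp_add, ← mul_assoc]
  simp only [hprod]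
  rw [integral_const_mul, integral_sub_right_eq_self (fun y => Real.exp (-β * y ^ 2)) m,
    integral_gaussian, heatKernel]
  have hc : 1 / √(4 * Real.pi * θ * r) * (1 / √(4 * Real.pi * θ * s)) * √(Real.pi / β)
      = 1 / √(4 * Real.pi * θ * (r + s)) := by
    have hπ := Real.pi_pos
    rw [← Real.sqrt_one, ← Real.sqrt_div zero_le_one, ← Real.sqrt_div zero_le_one,
      ← Real.sqrt_div zero_le_one, ← Real.sqrt_mul (by positivity), ← Real.sqrt_mul (by positivity)]
    congr 1
    rw [hβ]
    field_simp
  rw [← hc]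
  ring

variable {Ω : Type*} [MeasurableSpace Ω] {W : Lp ℝ 2 (volume : Measure ℝ) → Ω → ℝ} {P : Measure Ω}

theorem IsWhiteNoise.inner_integral (hW : IsWhiteNoise W P) (f g : Lp ℝ 2 (volume : Measure ℝ)) :
    inner ℝ (hW.integral f) (hW.integral g) = ∫ y, f y * g y := by
  rw [L2.inner_def, ← hW.covariance]
  refine integral_congr_ae ?_
  filter_upwards [(hW.memLp f).coeFn_toLp, (hW.memLp g).coeFn_toLp] with ω hf hg
  simp only [IsWhiteNoise.integral, hf, hg]
  simp [mul_comm]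

theorem inner_integral_heatKernelLp (hW : IsWhiteNoise W P) {θ r s : ℝ} (hθ : 0 < θ) (hr : 0 < r)
    (hs : 0 < s) (x x' : ℝ) :
    inner ℝ (hW.integral (heatKernelLp θ r x)) (hW.integral (heatKernelLp θ s x'))
      = heatKernel θ (r + s) (x - x') := by
  rw [hW.inner_integral, ← integral_heatKernel_mul_heatKernel hθ hr hs]
  refine integral_congr_ae ?_
  filter_upwards [(memLp_heatKernel θ r x).coeFn_toLp, (memLp_heatKernel θ s x').coeFn_toLp]
    with y h1 h2
  simp only [heatKernelLp, h1, h2]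

/-- Strong measurability of the integrand is obtained from continuity, which can be read off the
inner products `heatKernel θ (r + s) 0`. -/
theorem continuousOn_integral_heatKernelLp (hW : IsWhiteNoise W P) {θ : ℝ} (hθ : 0 < θ) (x : ℝ) :
    ContinuousOn (fun s => hW.integral (heatKernelLp θ s x)) (Set.Ioi 0) := by
  intro s (hs : 0 < s)
  refine ContinuousAt.continuousWithinAt ?_
  rw [ContinuousAt, tendsto_iff_norm_sub_tendsto_zero]
  have hsq : Tendsto (fun r => ‖hW.integral (heatKernelLp θ r x)
      - hW.integral (heatKernelLp θ s x)‖ ^ 2) (𝓝 s) (𝓝 0) := by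
    have hc : Tendsto (fun r => heatKernel θ (r + r) 0 - 2 * heatKernel θ (r + s) 0
        + heatKernel θ (s + s) 0) (𝓝 s) (𝓝 (heatKernel θ (s + s) 0 - 2 * heatKernel θ (s + s) 0
        + heatKernel θ (s + s) 0)) := by
      have h2 := (continuousAt_heatKernel_time (mul_pos hθ (add_pos hs hs)) 0).tendsto
      have hid : Tendsto (fun r : ℝ => r) (𝓝 s) (𝓝 s) := tendsto_id
      exact ((h2.comp (hid.add hid)).sub ((h2.comp (hid.add_const s)).const_mul 2)).add_const _
    rw [show heatKernel θ (s + s) 0 - 2 * heatKernel θ (s + s) 0 + heatKernel θ (s + s) 0 = 0 by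
      ring] at hc
    refine hc.congr' ?_
    filter_upwards [lt_mem_nhds hs] with r hr
    rw [norm_sub_sq_real, ← real_inner_self_eq_norm_sq, ← real_inner_self_eq_norm_sq,
      inner_integral_heatKernelLp hW hθ hr hr, inner_integral_heatKernelLp hW hθ hr hs,
      inner_integral_heatKernelLp hW hθ hs hs, sub_self]
  have h := hsq.sqrt
  simpa only [Real.sqrt_zero, Real.sqrt_sq (norm_nonneg _)] using h

/-- The norm of `∫ P(s, x - y) dW(y)` is a multiple of `s ^ (-1/4)`, hence integrable at `0`. -/
theorem intervalIntegrable_integral_heatKernelLp (hW : IsWhiteNoise W P) {θ t : ℝ} (hθ : 0 < θ)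
    (ht : 0 < t) (x : ℝ) :
    IntervalIntegrable (fun s => hW.integral (heatKernelLp θ s x)) volume 0 t := by
  have hr : IntervalIntegrable (fun s : ℝ => √(1 / √(8 * Real.pi * θ)) * s ^ (-(1 / 4) : ℝ))
      volume 0 t := (intervalIntegral.intervalIntegrable_rpow' (by norm_num)).const_mul _
  rw [intervalIntegrable_iff_integrableOn_Ioc_of_le ht.le] at hr ⊢
  refine Integrable.mono hr (((continuousOn_integral_heatKernelLp hW hθ x).mono
    Set.Ioc_subset_Ioi_self).aestronglyMeasurable measurableSet_Ioc) ?_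
  refine (ae_restrict_mem measurableSet_Ioc).mono fun s hs => ?_
  have hs0 : 0 < s := hs.1
  have hn : ‖hW.integral (heatKernelLp θ s x)‖ ^ 2
      = (√(1 / √(8 * Real.pi * θ)) * s ^ (-(1 / 4) : ℝ)) ^ 2 := by
    rw [← real_inner_self_eq_norm_sq, inner_integral_heatKernelLp hW hθ hs0 hs0, sub_self,
      mul_pow, Real.sq_sqrt (by positivity), ← Real.rpow_natCast, ← Real.rpow_mul hs0.le,
      heatKernel, show 4 * Real.pi * θ * (s + s) = 8 * Real.pi * θ * s by ring,
      Real.sqrt_mul (by positivity),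
      show (-(1 / 4) * ((2 : ℕ) : ℝ) : ℝ) = -(1 / 2) by norm_num, Real.rpow_neg hs0.le,
      ← Real.sqrt_eq_rpow]
    simp [mul_comm]
  rw [Real.norm_of_nonneg (show 0 ≤ √(1 / √(8 * Real.pi * θ)) * s ^ (-(1 / 4) : ℝ) by positivity)]
  exact ((sq_eq_sq₀ (norm_nonneg _) (by positivity)).1 hn).le

/-- The time integral `∫₀ᵗ ∫ P(s, x - y) dW(y) ds` in `L²(Ω)`. -/
def timeIntegral (hW : IsWhiteNoise W P) (θ t x : ℝ) : Lp ℝ 2 P :=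
  ∫ s in (0 : ℝ)..t, hW.integral (heatKernelLp θ s x)

theorem mildIntegral_eq (hW : IsWhiteNoise W P) (θ σ t x : ℝ) :
    mildIntegral hW θ σ t x = σ • timeIntegral hW θ t x := by
  rw [mildIntegral, timeIntegral, intervalIntegral.integral_comp_sub_left
    (fun s => hW.integral (heatKernelLp θ s x)), sub_self, sub_zero]

/-- The covariance function of the solution, for `σ = 1`. -/
theorem inner_timeIntegral (hW : IsWhiteNoise W P) {θ t : ℝ} (hθ : 0 < θ) (ht : 0 < t)
    (x x' : ℝ) :
    inner ℝ (timeIntegral hW θ t x) (timeIntegral hW θ t x')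
      = |x - x'| ^ 3 / (12 * θ ^ 2) + covSmooth θ t (x - x') := by
  have hY := intervalIntegrable_integral_heatKernelLp hW hθ ht
  have hinner : ∀ r ∈ Set.Ioc 0 t,
      inner ℝ (timeIntegral hW θ t x') (hW.integral (heatKernelLp θ r x))
        = ∫ s in (0 : ℝ)..t, heatKernel θ (r + s) (x - x') := fun r hr => by
    have h := ContinuousLinearMap.intervalIntegral_comp_comm
      (innerSL ℝ (hW.integral (heatKernelLp θ r x))) (hY x')
    simp only [innerSL_apply_apply] at h
    rw [real_inner_comm, timeIntegral, ← h, intervalIntegral.integral_of_le ht.le,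
      intervalIntegral.integral_of_le ht.le]
    exact setIntegral_congr_fun measurableSet_Ioc fun s hs =>
      inner_integral_heatKernelLp hW hθ hr.1 hs.1 x x'
  have hint : IntervalIntegrable
      (fun r => ∫ s in (0 : ℝ)..t, heatKernel θ (r + s) (x - x')) volume 0 t := by
    have h := (innerSL ℝ (timeIntegral hW θ t x')).integrable_comp
      ((intervalIntegrable_iff_integrableOn_Ioc_of_le ht.le).1 (hY x))
    rw [intervalIntegrable_iff_integrableOn_Ioc_of_le ht.le]
    exact IntegrableOn.congr_fun h hinner measurableSet_Ioc
  rw [← integral_integral_heatKernel hθ ht _ hint, real_inner_comm]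
  have h := ContinuousLinearMap.intervalIntegral_comp_comm
    (innerSL ℝ (timeIntegral hW θ t x')) (hY x)
  simp only [innerSL_apply_apply] at h
  rw [show timeIntegral hW θ t x = ∫ s in (0 : ℝ)..t, hW.integral (heatKernelLp θ s x) from rfl,
    ← h, intervalIntegral.integral_of_le ht.le, intervalIntegral.integral_of_le ht.le]
  exact setIntegral_congr_fun measurableSet_Ioc hinner

/-! ### The second moment of the increment -/

/-- The mixed second difference of `|z|³ / 12` at `0`. It is the squared norm of the convolution of
the indicator functions of two intervals, of lengths `d` and `l`. -/
def kinkVariance (d l : ℝ) : ℝ := secondDiff d (secondDiff l fun z => |z| ^ 3 / 12) 0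

theorem kinkVariance_comm (d l : ℝ) : kinkVariance d l = kinkVariance l d := by
  simp only [kinkVariance, secondDiff]
  ring_nf

theorem kinkVariance_of_le {d l : ℝ} (hl : 0 ≤ l) (h : l ≤ d) :
    kinkVariance d l = l ^ 2 * d - l ^ 3 / 3 := by
  have hd : 0 ≤ d := hl.trans h
  simp only [kinkVariance, secondDiff, zero_add, zero_sub]
  rw [abs_of_nonneg (add_nonneg hd hl), abs_of_nonneg (sub_nonneg.2 h),
    abs_of_nonneg hd, abs_of_nonneg hl,
    show -d + l = -(d - l) by ring, show -d - l = -(d + l) by ring, abs_neg, abs_neg, abs_neg,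
    abs_neg, abs_of_nonneg (add_nonneg hd hl), abs_of_nonneg (sub_nonneg.2 h), abs_of_nonneg hd,
    abs_of_nonneg hl, abs_zero]
  ring

theorem norm_sq_mixed_increment (hW : IsWhiteNoise W P) {θ t : ℝ} (hθ : 0 < θ) (ht : 0 < t)
    (y d l : ℝ) :
    ‖(timeIntegral hW θ t (y + d + l) - timeIntegral hW θ t (y + d))
        - (timeIntegral hW θ t (y + l) - timeIntegral hW θ t y)‖ ^ 2
      = kinkVariance d l / θ ^ 2 + secondDiff d (secondDiff l (covSmooth θ t)) 0 := by
  rw [← real_inner_self_eq_norm_sq]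
  simp only [inner_sub_left, inner_sub_right, inner_timeIntegral hW hθ ht]
  simp only [kinkVariance, secondDiff, zero_add, zero_sub, sub_self]
  ring_nf


theorem IsMildSolution.ae_eq_timeIntegral {hW : IsWhiteNoise W P} {θ σ : ℝ} {u : ℝ → ℝ → Ω → ℝ}
    (hu : IsMildSolution hW θ σ u) {t : ℝ} (ht : 0 ≤ t) (x : ℝ) :
    ∀ᵐ ω ∂P, u t x ω = σ * timeIntegral hW θ t x ω := by
  have h := hu t x ht
  rw [mildIntegral_eq] at h
  filter_upwards [h, Lp.coeFn_smul σ (timeIntegral hW θ t x)] with ω h1 h2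
  rw [h1, h2, Pi.smul_apply, smul_eq_mul]

theorem integral_sq_eq_norm_sq (f : Lp ℝ 2 P) : ∫ ω, f ω ^ 2 ∂P = ‖f‖ ^ 2 := by
  rw [← real_inner_self_eq_norm_sq, L2.inner_def]
  simp [sq]

/-- The four points `x + d + ah`, `x + d - bh`, `x + ah`, `x - bh` are `y + d + l`, `y + d`, `y + l`,
`y` with `y = x - bh` and `l = (a + b) h`. -/
theorem integral_sq_diffQuot_sub {hW : IsWhiteNoise W P} {θ σ : ℝ} {u : ℝ → ℝ → Ω → ℝ}
    (hu : IsMildSolution hW θ σ u) (hθ : 0 < θ) {t : ℝ} (ht : 0 < t) (a b h x d : ℝ) :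
    ∫ ω, |diffQuot a b h (fun y => u t y ω) (x + d) - diffQuot a b h (fun y => u t y ω) x| ^ 2 ∂P
      = (σ / ((a + b) * h)) ^ 2 * (kinkVariance d ((a + b) * h) / θ ^ 2
          + secondDiff d (secondDiff ((a + b) * h) (covSmooth θ t)) 0) := by
  set l := (a + b) * h with hl
  set y := x - b * h with hy
  have e1 : x + d + a * h = y + d + l := by rw [hy, hl]; ring
  have e2 : x + d - b * h = y + d := by rw [hy]; ring
  have e3 : x + a * h = y + l := by rw [hy, hl]; ring
  rw [← norm_sq_mixed_increment hW hθ ht y, ← sq_abs (σ / l), ← Real.norm_eq_abs, ← mul_pow,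
    ← norm_smul, ← integral_sq_eq_norm_sq]
  refine integral_congr_ae ?_
  set v := timeIntegral hW θ t with hv
  filter_upwards [hu.ae_eq_timeIntegral ht.le (y + d + l), hu.ae_eq_timeIntegral ht.le (y + d),
    hu.ae_eq_timeIntegral ht.le (y + l), hu.ae_eq_timeIntegral ht.le y,
    Lp.coeFn_smul (σ / l) (v (y + d + l) - v (y + d) - (v (y + l) - v y)),
    Lp.coeFn_sub (v (y + d + l) - v (y + d)) (v (y + l) - v y),
    Lp.coeFn_sub (v (y + d + l)) (v (y + d)), Lp.coeFn_sub (v (y + l)) (v y)]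
    with ω h1 h2 h3 h4 s1 s2 s3 s4
  simp only [diffQuot, e1, e2, e3, ← hy, ← hl]
  rw [sq_abs, h1, h2, h3, h4, s1, Pi.smul_apply, s2, Pi.sub_apply, s3, s4, Pi.sub_apply,
    Pi.sub_apply, smul_eq_mul]
  ring

/-! ### The limit -/

theorem tendsto_natCast_div_rpow {γ : ℝ} (hγ : 1 < γ) :
    Tendsto (fun N : ℕ => (N : ℝ) / (N : ℝ) ^ γ) atTop (𝓝 0) := by
  have h := (tendsto_rpow_neg_atTop (sub_pos.2 hγ)).comp tendsto_natCast_atTop_atTop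
  refine h.congr' ?_
  filter_upwards [eventually_ge_atTop 1] with N hN
  have hN0 : (0 : ℝ) < N := by exact_mod_cast hN
  simp only [Function.comp]
  rw [neg_sub, Real.rpow_sub hN0, Real.rpow_one]

/-- For `γ > 1` the step `c D / N ^ γ` is eventually the smaller one, and negligible against `D / N`. -/
theorem tendsto_kinkVariance {c D γ : ℝ} (hc : 0 < c) (hD : 0 < D) (hγ : 1 < γ) :
    Tendsto (fun N : ℕ => (N : ℝ) *
      (kinkVariance (D / N) (c * (D / (N : ℝ) ^ γ)) / (c * (D / (N : ℝ) ^ γ)) ^ 2))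
      atTop (𝓝 D) := by
  have hq := (tendsto_natCast_div_rpow hγ).const_mul c
  rw [mul_zero] at hq
  have hlim := (hq.mul_const (D / 3)).const_sub D
  rw [zero_mul, sub_zero] at hlim
  refine hlim.congr' ?_
  filter_upwards [eventually_ge_atTop 1, hq.eventually_le_const one_pos] with N hN hle
  have hN0 : (0 : ℝ) < N := by exact_mod_cast hN
  have hp : 0 < (N : ℝ) ^ γ := Real.rpow_pos_of_pos hN0 γ
  have hl : c * (D / (N : ℝ) ^ γ) = c * (N / (N : ℝ) ^ γ) * (D / N) := by field_simp
  rw [kinkVariance_of_le (by positivity)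
    (by rw [hl]; exact mul_le_of_le_one_left (by positivity) hle)]
  field_simp

theorem kinkVariance_div_of_le_one {c D : ℝ} (hc : 0 < c) (hc1 : c ≤ 1) (hD : 0 < D) {N : ℕ}
    (hN : 1 ≤ N) :
    (N : ℝ) * (kinkVariance (D / N) (c * (D / N)) / (c * (D / N)) ^ 2) = (1 - c / 3) * D := by
  have hN0 : (0 : ℝ) < N := by exact_mod_cast hN
  rw [kinkVariance_of_le (by positivity) (mul_le_of_le_one_left (by positivity) hc1)]
  field_simp

theorem kinkVariance_div_of_one_le {c D : ℝ} (hc1 : 1 ≤ c) (hD : 0 < D) {N : ℕ} (hN : 1 ≤ N) :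
    (N : ℝ) * (kinkVariance (D / N) (c * (D / N)) / (c * (D / N)) ^ 2)
      = (1 / c - 1 / (3 * c ^ 2)) * D := by
  have hN0 : (0 : ℝ) < N := by exact_mod_cast hN
  have hc : 0 < c := one_pos.trans_le hc1
  rw [kinkVariance_comm,
    kinkVariance_of_le (by positivity) (le_mul_of_one_le_left (by positivity) hc1)]
  field_simp

theorem tendsto_kinkVariance_biasFactor {a b D γ : ℝ} (hab : 0 < a + b) (hD : 0 < D)
    (hγ : 1 ≤ γ) :
    Tendsto (fun N : ℕ => (N : ℝ) *
      (kinkVariance (D / N) ((a + b) * (D / (N : ℝ) ^ γ)) / ((a + b) * (D / (N : ℝ) ^ γ)) ^ 2))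
      atTop (𝓝 (biasFactor γ a b * D)) := by
  rcases hγ.eq_or_lt with rfl | hγ
  · simp only [Real.rpow_one]
    refine tendsto_const_nhds.congr' ?_
    filter_upwards [eventually_ge_atTop 1] with N hN
    rcases le_or_gt 1 (a + b) with h | h
    · rw [kinkVariance_div_of_one_le h hD hN, biasFactor, if_pos rfl, if_pos h]
    · rw [kinkVariance_div_of_le_one hab h.le hD hN, biasFactor, if_pos rfl, if_neg h.not_ge]
  · rw [biasFactor, if_neg hγ.ne', one_mul]
    exact tendsto_kinkVariance hab hD hγ

theorem tendsto_secondDiff_covSmooth {θ t c D γ : ℝ} (hθ : 0 < θ) (ht : 0 < t) (hc : 0 < c)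
    (hD : 0 < D) :
    Tendsto (fun N : ℕ => (N : ℝ) *
      (secondDiff (D / N) (secondDiff (c * (D / (N : ℝ) ^ γ)) (covSmooth θ t)) 0
        / (c * (D / (N : ℝ) ^ γ)) ^ 2)) atTop (𝓝 0) := by
  obtain ⟨C, hC⟩ := exists_abs_secondDiff_covSmooth_le hθ ht
  have hlim : Tendsto (fun N : ℕ => C * D ^ 2 / (N : ℝ)) atTop (𝓝 0) :=
    tendsto_const_nhds.div_atTop tendsto_natCast_atTop_atTop
  refine squeeze_zero_norm' ?_ hlim
  filter_upwards [eventually_ge_atTop 1] with N hN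
  have hN0 : (0 : ℝ) < N := by exact_mod_cast hN
  have hl : 0 < c * (D / (N : ℝ) ^ γ) := by positivity
  rw [Real.norm_eq_abs, abs_mul, abs_div, abs_of_pos hN0, abs_of_pos (pow_pos hl 2)]
  calc _ ≤ (N : ℝ) * (C * (D / N) ^ 2 * (c * (D / (N : ℝ) ^ γ)) ^ 2
        / (c * (D / (N : ℝ) ^ γ)) ^ 2) := by
        gcongr
        exact hC _ _ (by positivity) hl.le
    _ = C * D ^ 2 / N := by
        rw [mul_div_cancel_right₀ _ (pow_pos hl 2).ne']
        field_simp

end SpaceNoiseHeat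
end

theorem proposition3p6 {Ω : Type*} [MeasurableSpace Ω] (P : Measure Ω) [IsProbabilityMeasure P]
    (W : Lp ℝ 2 (volume : Measure ℝ) → Ω → ℝ) (hW : SpaceNoiseHeat.IsWhiteNoise W P)
    (θ σ : ℝ) (hθ : 0 < θ)
    (u : ℝ → ℝ → Ω → ℝ) (hu : SpaceNoiseHeat.IsMildSolution hW θ σ u)
    (a b : ℝ) (ha : 0 ≤ a) (hb : 0 ≤ b) (hab : 0 < a + b)
    (A B : ℝ) (hAB : A < B) (γ : ℝ) (hγ : 1 ≤ γ)
    (t : ℝ) (ht : 0 < t) (x : ℝ) :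
    Tendsto
      (fun N : ℕ => (N : ℝ) *
        ∫ ω, |SpaceNoiseHeat.diffQuot a b ((B - A) / (N : ℝ) ^ γ) (fun y => u t y ω)
                (x + (B - A) / (N : ℝ))
              - SpaceNoiseHeat.diffQuot a b ((B - A) / (N : ℝ) ^ γ) (fun y => u t y ω) x| ^ 2 ∂P)
      atTop
      (𝓝 (SpaceNoiseHeat.biasFactor γ a b * σ ^ 2 * (B - A) / θ ^ 2)) := by
  have hD : 0 < B - A := sub_pos.2 hAB
  have hlim := (((SpaceNoiseHeat.tendsto_kinkVariance_biasFactor hab hD hγ).mul_const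
    (σ ^ 2 / θ ^ 2)).add ((SpaceNoiseHeat.tendsto_secondDiff_covSmooth (γ := γ) hθ ht hab hD
      ).const_mul (σ ^ 2)))
  rw [mul_zero, add_zero] at hlim
  convert hlim using 2
  · rw [SpaceNoiseHeat.integral_sq_diffQuot_sub hu hθ ht]
    generalize (a + b) * ((B - A) / _) = l
    ring
  · ring
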